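/- For real parameters $(\mu,\nu)\in\mathbb{R}^2$ put $a=\nu+\mu$, $b=\nu-\mu$, and let $T_{ab}:\mathbb{R}^2\to\mathbb{R}^2$ be the piecewise linear homeomorphism $$T_{ab}(x,y)=\begin{cases}(ax-y,\;x) & \text{if } x\ge 0,\\ (bx-y,\;x) & \text{if } x<0.\end{cases}$$ Let $\Omega_{SB}\subset\mathbb{R}^2$ be the set of all $(\mu,\nu)$ for which $T_{ab}$ has at least one nonzero bounded orbit, i.e. there is ${\bf v}\ne 0$ such that the two-sided orbit $\{T_{ab}^{n}({\bf v}) : n\in\mathbb{Z}\}$ is bounded. Let $S_{ab}(e^{i\theta})=T_{ab}(e^{i\theta})/|T_{ab}(e^{i\theta})|$ be the induced homeomorphism of the unit circle (where $e^{i\theta}=(\cos\theta,\sin\theta)$), and let $r(S_{ab})\in[0,1)$ be its rotation number, that is, $\lim_{n\to\infty}(F^{n}(t)-t)/n$ modulo $1$ for a continuous lift $F:\mathbb{R}\to\mathbb{R}$ of $S_{ab}$ under $t\mapsto e^{2\pi i t}$. Then $\Omega_{SB}$ is a closed subset of $\mathbb{R}^2$. Moreover, $\Omega_{SB}$ consists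 exactly of the parameters $(\mu,\nu)$ for which the associated $(a,b)$ satisfies one of the following conditions: (1) $r(S_{ab})$ is rational, and $T_{ab}$ has a periodic orbit (other than the fixed point $0$); (2) $r(S_{ab})$ is irrational. -/

import Mathlib

open Function

noncomputable section

namespace PLMap

/-- The coefficient `F_{ab}(x)`: it is `a` for `x ≥ 0` and `b` for `x < 0`. -/
def coeff (a b x : ℝ) : ℝ := if 0 ≤ x then a else b

/-- The piecewise linear bijection `T_{ab} (x, y) = (F_{ab}(x) x - y, x)` of the plane,
with inverse `(x, y) ↦ (y, F_{ab}(y) y - x)`. Its integer powers are its (two-sided) iterates. -/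
def T (a b : ℝ) : Equiv.Perm (ℝ × ℝ) where
  toFun v := (coeff a b v.1 * v.1 - v.2, v.1)
  invFun v := (v.2, coeff a b v.2 * v.2 - v.1)
  left_inv v := by ext <;> simp
  right_inv v := by ext <;> simp

/-- The vector `v` has a bounded two-sided orbit `{T^n v : n ∈ ℤ}`. -/
def HasBoundedOrbit (a b : ℝ) (v : ℝ × ℝ) : Prop :=
  Bornology.IsBounded (Set.range fun n : ℤ => (T a b ^ n) v)

/-- The set `Ω_SB` of the parameters `(μ, ν)` for which `T_{ab}`, with `a = ν + μ` and
`b = ν - μ`, has at least one nonzero bounded orbit. -/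
def OmegaSB : Set (ℝ × ℝ) :=
  {p | ∃ v : ℝ × ℝ, v ≠ 0 ∧ HasBoundedOrbit (p.2 + p.1) (p.2 - p.1) v}

/-- `T_{ab}` has a periodic orbit (other than the fixed point at the origin). -/
def HasPeriodicOrbit (a b : ℝ) : Prop :=
  ∃ v : ℝ × ℝ, v ≠ 0 ∧ v ∈ periodicPts (T a b)

/-- The value of `T_{ab}` at a point of the unit circle, as a complex number. -/
def TC (a b : ℝ) (z : Circle) : ℂ :=
  ⟨(T a b ((z : ℂ).re, (z : ℂ).im)).1, (T a b ((z : ℂ).re, (z : ℂ).im)).2⟩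

lemma TC_ne_zero (a b : ℝ) (z : Circle) : TC a b z ≠ 0 := by
  intro h
  have h1 := congrArg Complex.re h
  have h2 := congrArg Complex.im h
  simp only [TC, T, Equiv.coe_fn_mk, Complex.zero_re, Complex.zero_im] at h1 h2
  have h3 : (z : ℂ).im = 0 := by simpa [h2] using h1
  exact z.coe_ne_zero (Complex.ext h2 h3)

/-- The rotation map `S_{ab}(z) = T_{ab}(z) / |T_{ab}(z)|` of the unit circle. -/
def S (a b : ℝ) (z : Circle) : Circle :=
  ⟨TC a b z / (‖TC a b z‖ : ℂ), by
    have h : ‖TC a b z / (‖TC a b z‖ : ℂ)‖ = 1 := by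
      rw [norm_div, Complex.norm_real, norm_norm,
        div_self (norm_ne_zero_iff.mpr (TC_ne_zero a b z))]
    exact mem_sphere_zero_iff_norm.mpr h⟩

/-- `F` is a continuous lift of the circle map `f` along the covering `t ↦ exp (2 π i t)`
(counterclockwise angles, measured in turns). A `CircleDeg1Lift` is a monotone map of the line
with `F (t + 1) = F t + 1`. -/
def IsLift (F : CircleDeg1Lift) (f : Circle → Circle) : Prop :=
  Continuous F ∧ ∀ t : ℝ, Circle.exp (2 * Real.pi * F t) = f (Circle.exp (2 * Real.pi * t))

open Classical in
/-- The rotation number, in `[0, 1)`, of an orientation preserving degree one circle map: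
the limit of `(F^n (t) - t) / n`, modulo `1`, for a lift `F`. -/
def rotationNumber (f : Circle → Circle) : ℝ :=
  if h : ∃ F, IsLift F f then Int.fract h.choose.translationNumber else 0

/-! Well-definedness: the rotation number does not depend on the lift, and `S_{ab}` has a lift. -/

lemma IsLift.fract_eq {F G : CircleDeg1Lift} {f : Circle → Circle}
    (hF : IsLift F f) (hG : IsLift G f) :
    Int.fract F.translationNumber = Int.fract G.translationNumber := by
  have key : ∀ t, ∃ m : ℤ, F t = G t + m := by
    intro t
    have h := (hF.2 t).trans (hG.2 t).symm
    obtain ⟨m, hm⟩ := Circle.exp_eq_exp.mp h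
    refine ⟨m, ?_⟩
    have hpi := Real.pi_pos
    have : 2 * Real.pi * (F t - (G t + m)) = 0 := by linarith
    rcases mul_eq_zero.mp this with h | h <;> linarith
  choose m hm using key
  have hc : Continuous m := by
    rw [Int.isClosedEmbedding_coe_real.isEmbedding.continuous_iff]
    have : ((fun n : ℤ => (n : ℝ)) ∘ m) = fun t => F t - G t := by
      funext t; simp [hm t]
    exact this ▸ hF.1.sub hG.1
  have hconst : ∀ t, m t = m 0 := fun t => PreconnectedSpace.constant inferInstance hc
  have hFG : F = CircleDeg1Lift.translate (Multiplicative.ofAdd ((m 0 : ℤ) : ℝ)) * G := by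
    ext t
    simp [hm t, hconst t, add_comm]
  have hcomm : Commute (CircleDeg1Lift.translate (Multiplicative.ofAdd ((m 0 : ℤ) : ℝ)) :
      CircleDeg1Lift) G := by
    ext t
    simp
  rw [hFG, CircleDeg1Lift.translationNumber_mul_of_commute hcomm,
    CircleDeg1Lift.translationNumber_translate]
  simp

lemma IsLift.rotationNumber_eq {F : CircleDeg1Lift} {f : Circle → Circle} (hF : IsLift F f) :
    rotationNumber f = Int.fract F.translationNumber := by
  have h : ∃ F, IsLift F f := ⟨F, hF⟩
  rw [rotationNumber, dif_pos h]
  exact h.choose_spec.fract_eq hF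

lemma T_smul (a b : ℝ) {c : ℝ} (hc : 0 < c) (v : ℝ × ℝ) : T a b (c • v) = c • T a b v := by
  ext
  · simp only [T, coeff, Equiv.coe_fn_mk, Prod.smul_fst, Prod.smul_snd, smul_eq_mul,
      mul_nonneg_iff_of_pos_left hc]
    ring
  · simp [T]

lemma S_injective (a b : ℝ) : Injective (S a b) := by
  intro z w h
  have h' : TC a b z / (‖TC a b z‖ : ℂ) = TC a b w / (‖TC a b w‖ : ℂ) := congrArg Subtype.val h
  have hz : 0 < ‖TC a b z‖ := norm_pos_iff.mpr (TC_ne_zero a b z)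
  have hw : 0 < ‖TC a b w‖ := norm_pos_iff.mpr (TC_ne_zero a b w)
  set c : ℝ := ‖TC a b z‖ / ‖TC a b w‖ with hcdef
  have hc : 0 < c := div_pos hz hw
  have hzw : TC a b z = (c : ℂ) * TC a b w := by
    rw [div_eq_iff (by exact_mod_cast hz.ne')] at h'
    rw [h', hcdef]; push_cast; ring
  have hT : T a b ((z : ℂ).re, (z : ℂ).im) = T a b (c • ((w : ℂ).re, (w : ℂ).im)) := by
    rw [T_smul a b hc]
    have h1 := congrArg Complex.re hzw
    have h2 := congrArg Complex.im hzw
    rw [Complex.re_ofReal_mul] at h1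
    rw [Complex.im_ofReal_mul] at h2
    exact Prod.ext h1 h2
  have hv := (T a b).injective hT
  have hzc : (z : ℂ) = (c : ℂ) * (w : ℂ) := by
    apply Complex.ext
    · rw [Complex.re_ofReal_mul]; exact congrArg Prod.fst hv
    · rw [Complex.im_ofReal_mul]; exact congrArg Prod.snd hv
  have hn := congrArg norm hzc
  rw [norm_mul, Circle.norm_coe, Circle.norm_coe, Complex.norm_real, Real.norm_of_nonneg hc.le,
    mul_one] at hn
  apply Circle.ext
  rw [hzc, ← hn]; simp

/-- `T_{ab}(e^{iθ}) / (i e^{iθ})`, which never is a real number `≤ 0`. -/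
def turn (a b θ : ℝ) : ℂ := TC a b (Circle.exp θ) / (Complex.I * Circle.exp θ)

lemma turn_eq (a b θ : ℝ) : turn a b θ =
    ⟨1 - coeff a b (Real.cos θ) * Real.cos θ * Real.sin θ,
      -(coeff a b (Real.cos θ) * Real.cos θ * Real.cos θ)⟩ := by
  have h0 : Complex.I * (Circle.exp θ : ℂ) ≠ 0 :=
    mul_ne_zero Complex.I_ne_zero (Circle.exp θ).coe_ne_zero
  rw [turn, div_eq_iff h0]
  have hs := Real.sin_sq_add_cos_sq θ
  have hre : ((Circle.exp θ : Circle) : ℂ).re = Real.cos θ := by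
    rw [Circle.coe_exp, Complex.exp_ofReal_mul_I_re]
  have him : ((Circle.exp θ : Circle) : ℂ).im = Real.sin θ := by
    rw [Circle.coe_exp, Complex.exp_ofReal_mul_I_im]
  apply Complex.ext
  · simp only [TC, T, Equiv.coe_fn_mk, hre, him, Complex.mul_re, Complex.mul_im, Complex.I_re,
      Complex.I_im]
    linear_combination (-(coeff a b (Real.cos θ) * Real.cos θ)) * hs
  · simp only [TC, T, Equiv.coe_fn_mk, hre, him, Complex.mul_re, Complex.mul_im, Complex.I_re,
      Complex.I_im]
    ring

lemma turn_mem (a b θ : ℝ) : turn a b θ ∈ Complex.slitPlane := by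
  rw [turn_eq, Complex.mem_slitPlane_iff]
  by_cases h : coeff a b (Real.cos θ) * Real.cos θ = 0
  · left; simp [h]
  · right
    have hc : Real.cos θ ≠ 0 := right_ne_zero_of_mul h
    exact neg_ne_zero.mpr (mul_ne_zero h hc)

lemma continuous_turn (a b : ℝ) : Continuous (turn a b) := by
  have h : ∀ x : ℝ, coeff a b x * x = a * max x 0 + b * min x 0 := by
    intro x
    unfold coeff
    split_ifs with hx
    · simp [max_eq_left hx, min_eq_right hx]
    · have := (not_le.mp hx).le
      simp [max_eq_right this, min_eq_left this]
  have h2 : turn a b = fun θ => Complex.equivRealProdCLM.symm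
      (1 - (a * max (Real.cos θ) 0 + b * min (Real.cos θ) 0) * Real.sin θ,
        -((a * max (Real.cos θ) 0 + b * min (Real.cos θ) 0) * Real.cos θ)) := by
    funext θ
    rw [turn_eq, h]
    apply Complex.ext <;> simp
  rw [h2]
  fun_prop

lemma exists_isLift_S (a b : ℝ) : ∃ F, IsLift F (S a b) := by
  have hpi := Real.pi_pos
  let g : ℝ → ℝ := fun t => t + 1 / 4 + (turn a b (2 * Real.pi * t)).arg / (2 * Real.pi)
  have hg1 : ∀ t, g (t + 1) = g t + 1 := by
    intro t
    have : Circle.exp (2 * Real.pi * (t + 1)) = Circle.exp (2 * Real.pi * t) :=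
      Circle.exp_eq_exp.mpr ⟨1, by push_cast; ring⟩
    simp only [g, turn, this]; ring
  have hgS : ∀ t, Circle.exp (2 * Real.pi * g t) = S a b (Circle.exp (2 * Real.pi * t)) := by
    intro t
    have hw := turn_mem a b (2 * Real.pi * t)
    set z := Circle.exp (2 * Real.pi * t) with hz
    set w := turn a b (2 * Real.pi * t) with hwdef
    have hT : TC a b z = w * (Complex.I * z) := by
      rw [hwdef, turn, div_mul_cancel₀]
      exact mul_ne_zero Complex.I_ne_zero z.coe_ne_zero
    have harg : 2 * Real.pi * g t = 2 * Real.pi * t + Real.pi / 2 + w.arg := by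
      simp only [g, ← hwdef]; field_simp; ring
    have hw0 : (‖w‖ : ℂ) ≠ 0 := by
      exact_mod_cast norm_ne_zero_iff.mpr (Complex.slitPlane_ne_zero hw)
    have hpol := Complex.norm_mul_exp_arg_mul_I w
    apply Circle.ext
    rw [harg, Circle.exp_add, Circle.exp_add, ← hz]
    change _ = TC a b z / (‖TC a b z‖ : ℂ)
    rw [hT, norm_mul, norm_mul, Complex.norm_I, Circle.norm_coe, mul_one, mul_one,
      eq_div_iff hw0]
    have hI : ((Circle.exp (Real.pi / 2) : Circle) : ℂ) = Complex.I := by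
      rw [Circle.coe_exp]; push_cast; exact Complex.exp_pi_div_two_mul_I
    rw [Circle.coe_mul, Circle.coe_mul, hI, Circle.coe_exp w.arg]
    linear_combination (z * Complex.I : ℂ) * hpol
  have hgc : Continuous g := by
    have : Continuous fun t => (turn a b (2 * Real.pi * t)).arg := by
      rw [continuous_iff_continuousAt]
      intro t
      have h1 : Continuous fun t => turn a b (2 * Real.pi * t) :=
        (continuous_turn a b).comp (by fun_prop)
      exact ContinuousAt.comp (f := fun t => turn a b (2 * Real.pi * t))
        (Complex.continuousAt_arg (turn_mem a b _)) h1.continuousAt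
    fun_prop
  have hgn : ∀ t, ∀ n : ℕ, g (t + n) = g t + n := by
    intro t n
    induction n with
    | zero => simp
    | succ n ih => push_cast; rw [← add_assoc, hg1, ih]; ring
  have hgz : ∀ t, ∀ m : ℤ, g (t + m) = g t + m := by
    intro t m
    obtain ⟨n, rfl | rfl⟩ := m.eq_nat_or_neg
    · exact_mod_cast hgn t n
    · have := hgn (t + ((-(n : ℤ) : ℤ) : ℝ)) n
      push_cast at this ⊢
      rw [neg_add_cancel_right] at this
      linarith
  have hginj : Injective g := by
    intro x y hxy
    have h := (hgS x).symm.trans ((congrArg (fun u => Circle.exp (2 * Real.pi * u)) hxy).trans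
      (hgS y))
    obtain ⟨m, hm⟩ := Circle.exp_eq_exp.mp (S_injective a b h)
    have hx : x = y + m := by
      have : 2 * Real.pi * (x - (y + m)) = 0 := by linarith
      rcases mul_eq_zero.mp this with h | h <;> linarith
    rw [hx, hgz] at hxy
    rw [hx]; linarith
  have hmono : Monotone g := by
    rcases hgc.strictMono_of_inj hginj with h | h
    · exact h.monotone
    · have h1 := h (show (0 : ℝ) < 0 + 1 by norm_num)
      rw [hg1] at h1
      linarith
  exact ⟨⟨⟨g, hmono⟩, hg1⟩, hgc, hgS⟩

end PLMap

end

noncomputable section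

namespace PLMap

open Filter Topology

/-! ### Explicit lifts of the circle maps -/

/-! `T` is positively homogeneous and linear with determinant 1 on each half plane. It therefore
permutes rays, with angles moving by `lift`, and preserves the area form `det` on pairs of nearby
vectors.

Closedness: a nonzero bounded orbit can be rescaled to start on the unit sphere and stay in the ball
of radius 2. The parameter set is then the projection of a closed set along a compact sphere.

Rational rotation number: some `T^q` fixes a ray, and under it every angle converges to a fixed
angle `y`. Let `l` be the stretching factor there. If `l > 1` the orbit grows forwards. If `l < 1`,
area preservation makes the orbit grow, unless it lies on the ray at `y`, where it grows backwards.
So a bounded orbit forces `l = 1`, which is a periodic orbit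
(`hasPeriodicOrbit_of_bounded_of_rational`).

Irrational rotation number: adding `s` to both `a` and `b` moves `lift` monotonically. An
arbitrarily small `s` makes some iterate touch a translation by an integer from one side. Area
preservation gives stretching factor 1 at such a tangency (`stretch_eq_one_of_tangent`), hence a
periodic orbit. Parameters with bounded orbits thus accumulate at the given one, and closedness
finishes. -/

lemma coeff_mul_eq (a b x : ℝ) : coeff a b x * x = a * max x 0 + b * min x 0 := by
  unfold coeff
  split_ifs with hx
  · simp [max_eq_left hx, min_eq_right hx]
  · have := (not_le.mp hx).le
    simp [max_eq_right this, min_eq_left this]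

/-- The lift of `S a b` to the line (angles in turns) given by the principal argument of `turn`. -/
def liftFun (a b t : ℝ) : ℝ :=
  t + 1 / 4 + (turn a b (2 * Real.pi * t)).arg / (2 * Real.pi)

lemma exp_liftFun (a b t : ℝ) :
    Circle.exp (2 * Real.pi * liftFun a b t) = S a b (Circle.exp (2 * Real.pi * t)) := by
  have hpi := Real.pi_pos
  have hw := turn_mem a b (2 * Real.pi * t)
  set z := Circle.exp (2 * Real.pi * t) with hz
  set w := turn a b (2 * Real.pi * t) with hwdef
  have hT : TC a b z = w * (Complex.I * z) := by
    rw [hwdef, turn, div_mul_cancel₀]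
    exact mul_ne_zero Complex.I_ne_zero z.coe_ne_zero
  have harg : 2 * Real.pi * liftFun a b t = 2 * Real.pi * t + Real.pi / 2 + w.arg := by
    simp only [liftFun, ← hwdef]; field_simp; ring
  have hw0 : (‖w‖ : ℂ) ≠ 0 := by
    exact_mod_cast norm_ne_zero_iff.mpr (Complex.slitPlane_ne_zero hw)
  have hpol := Complex.norm_mul_exp_arg_mul_I w
  apply Circle.ext
  rw [harg, Circle.exp_add, Circle.exp_add, ← hz]
  change _ = TC a b z / (‖TC a b z‖ : ℂ)
  rw [hT, norm_mul, norm_mul, Complex.norm_I, Circle.norm_coe, mul_one, mul_one,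
    eq_div_iff hw0]
  have hI : ((Circle.exp (Real.pi / 2) : Circle) : ℂ) = Complex.I := by
    rw [Circle.coe_exp]; push_cast; exact Complex.exp_pi_div_two_mul_I
  rw [Circle.coe_mul, Circle.coe_mul, hI, Circle.coe_exp w.arg]
  linear_combination (z * Complex.I : ℂ) * hpol

/-- `turn` avoids the branch cut of `arg`. Continuity is joint in the parameters because they are
deformed later. -/
lemma continuous_liftFun : Continuous fun p : ℝ × ℝ × ℝ => liftFun p.1 p.2.1 p.2.2 := by
  have h2 : (fun p : ℝ × ℝ × ℝ => turn p.1 p.2.1 (2 * Real.pi * p.2.2)) =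
      fun p => Complex.equivRealProdCLM.symm
      (1 - (p.1 * max (Real.cos (2 * Real.pi * p.2.2)) 0 +
          p.2.1 * min (Real.cos (2 * Real.pi * p.2.2)) 0) * Real.sin (2 * Real.pi * p.2.2),
        -((p.1 * max (Real.cos (2 * Real.pi * p.2.2)) 0 +
          p.2.1 * min (Real.cos (2 * Real.pi * p.2.2)) 0) * Real.cos (2 * Real.pi * p.2.2))) := by
    funext p
    rw [turn_eq, coeff_mul_eq]
    apply Complex.ext <;> simp
  have h3 : Continuous fun p : ℝ × ℝ × ℝ => turn p.1 p.2.1 (2 * Real.pi * p.2.2) := by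
    rw [h2]; fun_prop
  have h4 : Continuous fun p : ℝ × ℝ × ℝ => (turn p.1 p.2.1 (2 * Real.pi * p.2.2)).arg := by
    rw [continuous_iff_continuousAt]
    intro p
    exact ContinuousAt.comp (f := fun p : ℝ × ℝ × ℝ => turn p.1 p.2.1 (2 * Real.pi * p.2.2))
      (Complex.continuousAt_arg (turn_mem _ _ _)) h3.continuousAt
  unfold liftFun
  fun_prop

lemma continuous_liftFun_right (a b : ℝ) : Continuous (liftFun a b) :=
  continuous_liftFun.comp (f := fun t : ℝ => (a, b, t)) (by fun_prop)

lemma liftFun_injective (a b : ℝ) : Injective (liftFun a b) := by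
  have hpi := Real.pi_pos
  have h1 : ∀ t, liftFun a b (t + 1) = liftFun a b t + 1 := by
    intro t
    have : Circle.exp (2 * Real.pi * (t + 1)) = Circle.exp (2 * Real.pi * t) :=
      Circle.exp_eq_exp.mpr ⟨1, by push_cast; ring⟩
    simp only [liftFun, turn, this]; ring
  have hz : ∀ t, ∀ m : ℤ, liftFun a b (t + m) = liftFun a b t + m := by
    intro t m
    induction m with
    | zero => simp
    | succ i ih => push_cast at ih ⊢; rw [← add_assoc, h1, ih]; ring
    | pred i ih =>
      have := h1 (t + ((-(i : ℤ) - 1 : ℤ) : ℝ))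
      push_cast at ih this ⊢
      rw [show t + (-(i : ℝ) - 1) + 1 = t + -(i : ℝ) by ring, ih] at this
      linarith
  intro x y hxy
  have h := (exp_liftFun a b x).symm.trans
    ((congrArg (fun u => Circle.exp (2 * Real.pi * u)) hxy).trans (exp_liftFun a b y))
  obtain ⟨m, hm⟩ := Circle.exp_eq_exp.mp (S_injective a b h)
  have hx : x = y + m := by
    have : 2 * Real.pi * (x - (y + m)) = 0 := by linarith
    rcases mul_eq_zero.mp this with h | h <;> linarith
  rw [hx, hz] at hxy
  rw [hx]; linarith

/-- `liftFun` as a degree one lift. -/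
def lift (a b : ℝ) : CircleDeg1Lift where
  toFun := liftFun a b
  map_add_one' t := by
    have : Circle.exp (2 * Real.pi * (t + 1)) = Circle.exp (2 * Real.pi * t) :=
      Circle.exp_eq_exp.mpr ⟨1, by push_cast; ring⟩
    simp only [liftFun, turn, this]; ring
  monotone' := by
    rcases (continuous_liftFun_right a b).strictMono_of_inj (liftFun_injective a b) with h | h
    · exact h.monotone
    · have h1 := h (show (0 : ℝ) < 0 + 1 by norm_num)
      have : Circle.exp (2 * Real.pi * (0 + 1)) = Circle.exp (2 * Real.pi * 0) :=
        Circle.exp_eq_exp.mpr ⟨1, by push_cast; ring⟩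
      simp only [liftFun, turn, this] at h1
      linarith

lemma lift_apply (a b t : ℝ) : lift a b t = liftFun a b t := rfl

lemma strictMono_lift (a b : ℝ) : StrictMono (lift a b) :=
  (lift a b).strictMono_iff_injective.mpr (liftFun_injective a b)

lemma continuous_lift (a b : ℝ) : Continuous (lift a b) := continuous_liftFun_right a b

lemma isLift_lift (a b : ℝ) : IsLift (lift a b) (S a b) :=
  ⟨continuous_lift a b, exp_liftFun a b⟩

lemma rotationNumber_S (a b : ℝ) :
    rotationNumber (S a b) = Int.fract (lift a b).translationNumber :=
  (isLift_lift a b).rotationNumber_eq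

/-- Iterates of the lift depend continuously on the parameters and the point. -/
lemma continuous_lift_iterate (n : ℕ) :
    Continuous fun p : ℝ × ℝ × ℝ => (lift p.1 p.2.1)^[n] p.2.2 := by
  induction n with
  | zero => simp only [iterate_zero, id]; fun_prop
  | succ n ih =>
    simp only [iterate_succ_apply']
    exact continuous_liftFun.comp (f := fun p : ℝ × ℝ × ℝ =>
      (p.1, p.2.1, (lift p.1 p.2.1)^[n] p.2.2)) (by fun_prop)

/-- The cross product is `‖z‖ ‖w‖ sin (arg w - arg z)`. Its sign decides the order of the arguments
unless they differ by more than `π`, and the hypothesis on imaginary parts excludes that. -/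
lemma arg_lt_arg_of_cross_neg {z w : ℂ} (him : w.im ≤ z.im)
    (h : z.re * w.im - z.im * w.re < 0) : w.arg < z.arg := by
  by_contra! hle
  have hsin : ‖z‖ * ‖w‖ * Real.sin (w.arg - z.arg) = z.re * w.im - z.im * w.re := by
    rw [Real.sin_sub, ← Complex.norm_mul_cos_arg z, ← Complex.norm_mul_cos_arg w,
      ← Complex.norm_mul_sin_arg z, ← Complex.norm_mul_sin_arg w]
    ring
  have hneg : Real.sin (w.arg - z.arg) < 0 := by
    by_contra! h0
    have := mul_nonneg (mul_nonneg (norm_nonneg z) (norm_nonneg w)) h0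
    linarith
  have hgt : Real.pi < w.arg - z.arg := by
    by_contra! h0
    exact absurd (Real.sin_nonneg_of_nonneg_of_le_pi (by linarith) h0) (not_le.mpr hneg)
  have h1 := Complex.neg_pi_lt_arg z
  have h2 := Complex.arg_le_pi w
  have h3 : 0 ≤ w.im := Complex.arg_nonneg_iff.mp (by linarith)
  have h4 : z.im < 0 := Complex.arg_neg_iff.mp (by linarith)
  linarith

/-- Raising both parameters turns the image of every direction off the second axis clockwise. -/
lemma lift_add_lt (a b t : ℝ) {s : ℝ} (hs : 0 < s) (ht : Real.cos (2 * Real.pi * t) ≠ 0) :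
    lift (a + s) (b + s) t < lift a b t := by
  have hpi := Real.pi_pos
  have hc : ∀ x, coeff (a + s) (b + s) x = coeff a b x + s := by
    intro x; unfold coeff; split_ifs <;> rfl
  have hpos : 0 < Real.cos (2 * Real.pi * t) ^ 2 := by positivity
  -- The cross product of the two values of `turn` is `-s cos²`.
  have : (turn (a + s) (b + s) (2 * Real.pi * t)).arg < (turn a b (2 * Real.pi * t)).arg := by
    apply arg_lt_arg_of_cross_neg
    · rw [turn_eq, turn_eq, hc]
      dsimp only
      nlinarith [mul_pos hs hpos]
    · rw [turn_eq, turn_eq, hc]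
      dsimp only
      nlinarith [mul_pos hs hpos]
  simp only [lift_apply, liftFun]
  gcongr

lemma lift_add_eq (a b t s : ℝ) (ht : Real.cos (2 * Real.pi * t) = 0) :
    lift (a + s) (b + s) t = lift a b t := by
  simp only [lift_apply, liftFun, turn_eq, ht, mul_zero, zero_mul]

/-! ### Action of `T` on rays -/

/-- The unit vector at angle `t`, measured in turns. -/
def dir (t : ℝ) : ℝ × ℝ := (Real.cos (2 * Real.pi * t), Real.sin (2 * Real.pi * t))

lemma continuous_dir : Continuous dir := by unfold dir; fun_prop

lemma dir_ne_zero (t : ℝ) : dir t ≠ 0 := by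
  intro h
  have h1 : Real.cos (2 * Real.pi * t) = 0 := congrArg Prod.fst h
  have h2 : Real.sin (2 * Real.pi * t) = 0 := congrArg Prod.snd h
  have := Real.sin_sq_add_cos_sq (2 * Real.pi * t)
  rw [h1, h2] at this
  norm_num at this

lemma dir_add_int (t : ℝ) (m : ℤ) : dir (t + m) = dir t := by
  unfold dir
  rw [show 2 * Real.pi * (t + m) = 2 * Real.pi * t + m * (2 * Real.pi) by ring,
    Real.cos_add_int_mul_two_pi, Real.sin_add_int_mul_two_pi]

lemma exists_eq_smul_dir {v : ℝ × ℝ} (hv : v ≠ 0) : ∃ c t : ℝ, 0 < c ∧ v = c • dir t := by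
  have hpi := Real.pi_pos
  set z : ℂ := ⟨v.1, v.2⟩ with hz
  have hz0 : z ≠ 0 := fun h =>
    hv (Prod.ext (congrArg Complex.re h) (congrArg Complex.im h))
  refine ⟨‖z‖, z.arg / (2 * Real.pi), norm_pos_iff.mpr hz0, ?_⟩
  have : 2 * Real.pi * (z.arg / (2 * Real.pi)) = z.arg := by field_simp
  unfold dir
  rw [this]
  exact Prod.ext (Complex.norm_mul_cos_arg z).symm (Complex.norm_mul_sin_arg z).symm

lemma exists_T_dir (a b t : ℝ) : ∃ r : ℝ, 0 < r ∧ T a b (dir t) = r • dir (lift a b t) := by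
  have h := congrArg Subtype.val (exp_liftFun a b t)
  have hpos : 0 < ‖TC a b (Circle.exp (2 * Real.pi * t))‖ := norm_pos_iff.mpr (TC_ne_zero a b _)
  refine ⟨_, hpos, ?_⟩
  change ((Circle.exp _ : Circle) : ℂ) = TC a b _ / (‖TC a b _‖ : ℂ) at h
  rw [eq_div_iff (by exact_mod_cast hpos.ne')] at h
  have hre : ∀ θ : ℝ, ((Circle.exp θ : Circle) : ℂ).re = Real.cos θ := fun θ => by
    rw [Circle.coe_exp, Complex.exp_ofReal_mul_I_re]
  have him : ∀ θ : ℝ, ((Circle.exp θ : Circle) : ℂ).im = Real.sin θ := fun θ => by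
    rw [Circle.coe_exp, Complex.exp_ofReal_mul_I_im]
  have h1 := congrArg Complex.re h
  have h2 := congrArg Complex.im h
  rw [Complex.re_mul_ofReal, hre] at h1
  rw [Complex.im_mul_ofReal, him] at h2
  have e : TC a b (Circle.exp (2 * Real.pi * t)) = ⟨(T a b (dir t)).1, (T a b (dir t)).2⟩ := by
    simp only [TC, hre, him, dir]
  apply Prod.ext
  · rw [Prod.smul_fst, smul_eq_mul, mul_comm]
    exact (h1.trans (congrArg Complex.re e)).symm
  · rw [Prod.smul_snd, smul_eq_mul, mul_comm]
    exact (h2.trans (congrArg Complex.im e)).symm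

lemma T_iterate_smul (a b : ℝ) (n : ℕ) {c : ℝ} (hc : 0 < c) (v : ℝ × ℝ) :
    (T a b)^[n] (c • v) = c • (T a b)^[n] v := by
  induction n with
  | zero => rfl
  | succ n ih => rw [iterate_succ_apply', iterate_succ_apply', ih, T_smul a b hc]

lemma exists_T_iterate_dir (a b t : ℝ) (n : ℕ) :
    ∃ r : ℝ, 0 < r ∧ (T a b)^[n] (dir t) = r • dir ((lift a b)^[n] t) := by
  induction n with
  | zero => exact ⟨1, one_pos, by simp⟩
  | succ n ih =>
    obtain ⟨r, hr, h⟩ := ih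
    obtain ⟨r', hr', h'⟩ := exists_T_dir a b ((lift a b)^[n] t)
    refine ⟨r * r', mul_pos hr hr', ?_⟩
    rw [iterate_succ_apply', h, T_smul a b hr, h', smul_smul, iterate_succ_apply']

/-- The Euclidean norm on the plane. -/
def nrm (v : ℝ × ℝ) : ℝ := √(v.1 ^ 2 + v.2 ^ 2)

lemma continuous_nrm : Continuous nrm := by unfold nrm; fun_prop

lemma nrm_smul_dir {c : ℝ} (hc : 0 ≤ c) (t : ℝ) : nrm (c • dir t) = c := by
  unfold nrm dir
  simp only [Prod.smul_mk, smul_eq_mul]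
  rw [show ∀ x y : ℝ, (c * x) ^ 2 + (c * y) ^ 2 = c ^ 2 * (y ^ 2 + x ^ 2) by intros; ring,
    Real.sin_sq_add_cos_sq, mul_one, Real.sqrt_sq hc]

/-- The stretching factor of `T^n` on the ray at angle `t`. -/
def stretch (a b : ℝ) (n : ℕ) (t : ℝ) : ℝ := nrm ((T a b)^[n] (dir t))

lemma T_iterate_dir (a b t : ℝ) (n : ℕ) :
    (T a b)^[n] (dir t) = stretch a b n t • dir ((lift a b)^[n] t) := by
  obtain ⟨r, hr, h⟩ := exists_T_iterate_dir a b t n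
  rw [stretch, h, nrm_smul_dir hr.le]

lemma stretch_pos (a b t : ℝ) (n : ℕ) : 0 < stretch a b n t := by
  obtain ⟨r, hr, h⟩ := exists_T_iterate_dir a b t n
  rw [stretch, h, nrm_smul_dir hr.le]
  exact hr

/-! ### Continuity and the area form -/

lemma continuous_T_uncurry :
    Continuous fun p : (ℝ × ℝ) × (ℝ × ℝ) => T p.1.1 p.1.2 p.2 := by
  have : (fun p : (ℝ × ℝ) × (ℝ × ℝ) => T p.1.1 p.1.2 p.2) =
      fun p => (p.1.1 * max p.2.1 0 + p.1.2 * min p.2.1 0 - p.2.2, p.2.1) := by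
    funext p
    rw [← coeff_mul_eq]; rfl
  rw [this]; fun_prop

lemma continuous_T_symm_uncurry :
    Continuous fun p : (ℝ × ℝ) × (ℝ × ℝ) => (T p.1.1 p.1.2).symm p.2 := by
  have : (fun p : (ℝ × ℝ) × (ℝ × ℝ) => (T p.1.1 p.1.2).symm p.2) =
      fun p => (p.2.2, p.1.1 * max p.2.2 0 + p.1.2 * min p.2.2 0 - p.2.1) := by
    funext p
    rw [← coeff_mul_eq]; rfl
  rw [this]; fun_prop

lemma continuous_T (a b : ℝ) : Continuous (T a b) :=
  continuous_T_uncurry.comp (f := fun v : ℝ × ℝ => ((a, b), v)) (by fun_prop)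

lemma continuous_stretch (a b : ℝ) (n : ℕ) : Continuous (stretch a b n) :=
  continuous_nrm.comp (((continuous_T a b).iterate n).comp continuous_dir)

/-- The area form on the plane. -/
def det (v w : ℝ × ℝ) : ℝ := v.1 * w.2 - v.2 * w.1

lemma det_smul_dir (c d s t : ℝ) :
    det (c • dir s) (d • dir t) = c * d * Real.sin (2 * Real.pi * (t - s)) := by
  simp only [det, dir, Prod.smul_mk, smul_eq_mul]
  rw [mul_sub, Real.sin_sub]; ring

/-- The hypothesis puts both vectors in a common closed half plane, where `T` is linear of
determinant 1. -/
lemma det_T_of_mul_nonneg (a b : ℝ) {v w : ℝ × ℝ} (h : 0 ≤ v.1 * w.1) :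
    det (T a b v) (T a b w) = det v w := by
  have key : v.1 * w.1 * (coeff a b v.1 - coeff a b w.1) = 0 := by
    unfold coeff
    split_ifs with h1 h2 h2
    · simp
    · have : v.1 = 0 := by nlinarith [not_le.mp h2]
      simp [this]
    · have : w.1 = 0 := by nlinarith [not_le.mp h1]
      simp [this]
    · simp
  simp only [det, T, Equiv.coe_fn_mk]
  linear_combination key

/-- `T^n` preserves the area spanned by `w` and any vector close to `w`. -/
lemma eventually_det_T_iterate (a b : ℝ) (n : ℕ) (w : ℝ × ℝ) :
    ∀ᶠ v in 𝓝 w, det ((T a b)^[n] v) ((T a b)^[n] w) = det v w := by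
  induction n with
  | zero => exact Eventually.of_forall fun _ => rfl
  | succ n ih =>
    -- If the image of `w` lies on the second axis, any vector shares a closed half plane with it;
    -- otherwise continuity preserves the sign of the first coordinate.
    have hs : ∀ᶠ v in 𝓝 w, 0 ≤ ((T a b)^[n] v).1 * ((T a b)^[n] w).1 := by
      by_cases h0 : ((T a b)^[n] w).1 = 0
      · simp [h0]
      · have hc : Continuous fun v => ((T a b)^[n] v).1 * ((T a b)^[n] w).1 :=
          (continuous_fst.comp ((continuous_T a b).iterate n)).mul continuous_const
        exact (hc.continuousAt.eventually_const_lt (mul_self_pos.mpr h0)).mono fun _ h => h.le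
    filter_upwards [ih, hs] with v h1 h2
    rw [iterate_succ_apply', iterate_succ_apply', det_T_of_mul_nonneg a b h2, h1]

/-! ### The parameter set is closed -/

lemma T_zpow_smul (a b : ℝ) (n : ℤ) {c : ℝ} (hc : 0 < c) (v : ℝ × ℝ) :
    (T a b ^ n) (c • v) = c • (T a b ^ n) v := by
  have hinv : ∀ v, (T a b)⁻¹ (c • v) = c • (T a b)⁻¹ v := fun v => by
    rw [Equiv.Perm.inv_eq_iff_eq, T_smul a b hc]; simp
  induction n generalizing v with
  | zero => simp
  | succ i ih => rw [zpow_add_one, Equiv.Perm.mul_apply, Equiv.Perm.mul_apply, T_smul a b hc, ih]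
  | pred i ih => rw [zpow_sub_one, Equiv.Perm.mul_apply, Equiv.Perm.mul_apply, hinv, ih]

lemma continuous_T_zpow (n : ℤ) :
    Continuous fun p : (ℝ × ℝ) × (ℝ × ℝ) => (T p.1.1 p.1.2 ^ n) p.2 := by
  induction n with
  | zero => simp only [zpow_zero, Equiv.Perm.one_apply]; fun_prop
  | succ i ih =>
    simp only [zpow_add_one, Equiv.Perm.mul_apply]
    exact ih.comp (continuous_fst.prodMk continuous_T_uncurry)
  | pred i ih =>
    simp only [zpow_sub_one, Equiv.Perm.mul_apply]
    exact ih.comp (continuous_fst.prodMk continuous_T_symm_uncurry)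

lemma hasBoundedOrbit_iff {a b : ℝ} {v : ℝ × ℝ} :
    HasBoundedOrbit a b v ↔ ∃ M, ∀ n : ℤ, ‖(T a b ^ n) v‖ ≤ M := by
  simp [HasBoundedOrbit, isBounded_iff_forall_norm_le]

/-- A nonzero bounded orbit can be rescaled so that it contains a unit vector and
stays in the ball of radius `2`. -/
lemma HasBoundedOrbit.exists_norm_le_two {a b : ℝ} {v : ℝ × ℝ} (hv : v ≠ 0)
    (h : HasBoundedOrbit a b v) : ∃ w : ℝ × ℝ, ‖w‖ = 1 ∧ ∀ n : ℤ, ‖(T a b ^ n) w‖ ≤ 2 := by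
  obtain ⟨M, hM⟩ := hasBoundedOrbit_iff.mp h
  have hbdd : BddAbove (Set.range fun n : ℤ => ‖(T a b ^ n) v‖) := ⟨M, by rintro _ ⟨n, rfl⟩; exact hM n⟩
  set B := ⨆ n : ℤ, ‖(T a b ^ n) v‖ with hB
  have hle : ∀ n : ℤ, ‖(T a b ^ n) v‖ ≤ B := fun n => le_ciSup hbdd n
  have hBpos : 0 < B := (norm_pos_iff.mpr hv).trans_le (by simpa using hle 0)
  -- The supremum need not be attained; a point above half of it suffices and accounts for the bound
  -- 2.
  obtain ⟨m, hm⟩ := exists_lt_of_lt_ciSup (show B / 2 < B by linarith)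
  set u := (T a b ^ m) v with hu
  have hupos : 0 < ‖u‖ := by linarith
  refine ⟨‖u‖⁻¹ • u, ?_, fun n => ?_⟩
  · rw [norm_smul, norm_inv, norm_norm, inv_mul_cancel₀ hupos.ne']
  · rw [T_zpow_smul a b n (inv_pos.mpr hupos), norm_smul, norm_inv, norm_norm, hu,
      ← Equiv.Perm.mul_apply, ← zpow_add, inv_mul_le_iff₀ hupos]
    have := hle (n + m)
    linarith

/-- The uniform bound 2 makes the condition on (parameter, unit vector) closed, and projecting along
the compact sphere is a closed map. -/
theorem isClosed_omegaSB : IsClosed OmegaSB := by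
  have heq : OmegaSB = Prod.fst '' {q : (ℝ × ℝ) × Metric.sphere (0 : ℝ × ℝ) 1 |
      ∀ n : ℤ, ‖(T (q.1.2 + q.1.1) (q.1.2 - q.1.1) ^ n) (q.2 : ℝ × ℝ)‖ ≤ 2} := by
    ext p
    constructor
    · rintro ⟨v, hv, h⟩
      obtain ⟨w, hw, hle⟩ := h.exists_norm_le_two hv
      exact ⟨(p, ⟨w, mem_sphere_zero_iff_norm.mpr hw⟩), hle, rfl⟩
    · rintro ⟨⟨p, w, hw⟩, hle, rfl⟩
      refine ⟨w, ?_, hasBoundedOrbit_iff.mpr ⟨2, hle⟩⟩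
      rintro rfl
      simp at hw
  rw [heq]
  apply isClosedMap_fst_of_compactSpace
  simp only [Set.ofPred_forall]
  refine isClosed_iInter fun n => isClosed_le (continuous_norm.comp ?_) continuous_const
  exact (continuous_T_zpow n).comp (f := fun q : (ℝ × ℝ) × Metric.sphere (0 : ℝ × ℝ) 1 =>
    ((q.1.2 + q.1.1, q.1.2 - q.1.1), (q.2 : ℝ × ℝ))) (by fun_prop)

lemma HasPeriodicOrbit.exists_bounded {a b : ℝ} (h : HasPeriodicOrbit a b) :
    ∃ v : ℝ × ℝ, v ≠ 0 ∧ HasBoundedOrbit a b v := by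
  obtain ⟨v, hv, q, hq, hper⟩ := h
  refine ⟨v, hv, ?_⟩
  have hfix : ∀ k : ℤ, (T a b ^ ((q : ℤ) * k)) v = v := by
    intro k
    rw [zpow_mul, zpow_natCast]
    apply Equiv.Perm.zpow_apply_eq_self_of_apply_eq_self
    rw [← Equiv.Perm.iterate_eq_pow]
    exact hper
  apply (Set.Finite.subset (Set.toFinite
    ((fun n : ℤ => (T a b ^ n) v) '' (Set.Ico (0 : ℤ) q))) ?_).isBounded
  rintro _ ⟨n, rfl⟩
  have hq' : (0 : ℤ) < q := by exact_mod_cast hq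
  refine ⟨n % q, ⟨Int.emod_nonneg _ hq'.ne', Int.emod_lt_of_pos _ hq'⟩, ?_⟩
  dsimp only
  conv_rhs => rw [← Int.emod_add_mul_ediv n q, zpow_add, Equiv.Perm.mul_apply, hfix]

/-! ### Bounded orbits at rational rotation numbers -/

/-- The iterates of a point under a continuous degree one lift with a fixed point converge to a
fixed point. -/
lemma exists_tendsto_iterate {f : ℝ → ℝ} (hm : Monotone f) (hc : Continuous f)
    (hper : ∀ (t : ℝ) (m : ℤ), f (t + m) = f t + m) {x₀ : ℝ} (hx : f x₀ = x₀) (t : ℝ) :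
    ∃ y, f y = y ∧ Tendsto (fun n => f^[n] t) atTop (𝓝 y) := by
  have hfix : ∀ (m : ℤ) (n : ℕ), f^[n] (x₀ + m) = x₀ + m := fun m n =>
    iterate_fixed (by rw [hper, hx]) n
  -- The iterates are monotone in `n` and trapped by an integer translate of `x₀`, which is again
  -- fixed.
  have key : ∃ y, Tendsto (fun n => f^[n] t) atTop (𝓝 y) := by
    rcases le_total t (f t) with h | h
    · refine ⟨_, tendsto_atTop_ciSup (hm.monotone_iterate_of_le_map h) ⟨x₀ + ⌈t - x₀⌉, ?_⟩⟩
      rintro _ ⟨n, rfl⟩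
      rw [← hfix _ n]
      exact hm.iterate n (by linarith [Int.le_ceil (t - x₀)])
    · refine ⟨_, tendsto_atTop_ciInf (hm.antitone_iterate_of_map_le h) ⟨x₀ + ⌊t - x₀⌋, ?_⟩⟩
      rintro _ ⟨n, rfl⟩
      rw [← hfix _ n]
      exact hm.iterate n (by linarith [Int.floor_le (t - x₀)])
  obtain ⟨y, hy⟩ := key
  exact ⟨y, isFixedPt_of_tendsto_iterate hy hc.continuousAt, hy⟩

lemma nrm_le_two_mul_norm (v : ℝ × ℝ) : nrm v ≤ 2 * ‖v‖ := by
  have h1 := norm_fst_le v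
  have h2 := norm_snd_le v
  rw [Real.norm_eq_abs, abs_le] at h1 h2
  exact Real.sqrt_le_iff.mpr ⟨by positivity, by nlinarith⟩

/-- A positive late term would start geometric growth past `M`. This serves for areas and for
forward and backward lengths. -/
lemma eventually_nonpos_of_geom_growth {d : ℕ → ℝ} {r M : ℝ} (hr : 1 < r)
    (hM : ∀ n, d n ≤ M) (hd : ∀ᶠ n in atTop, r * d n ≤ d (n + 1)) :
    ∀ᶠ n in atTop, d n ≤ 0 := by
  obtain ⟨N, hN⟩ := eventually_atTop.mp hd
  filter_upwards [eventually_ge_atTop N] with n hn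
  by_contra! h
  have ht := tendsto_atTop_of_geom_le (v := fun k => d (n + k)) h hr
    fun k => hN (n + k) (by omega)
  obtain ⟨k, hk⟩ := (ht.eventually_gt_atTop M).exists
  exact absurd (hM _) (not_le.mpr hk)

/-- The translation number differs from the rotation number by an integer, so it is rational too,
and a continuous lift then has a point that is periodic modulo 1. -/
lemma exists_iterate_eq_add_int {a b : ℝ}
    (h : ∃ q : ℚ, rotationNumber (S a b) = (q : ℝ)) :
    ∃ (q : ℕ) (p : ℤ) (x : ℝ), 0 < q ∧ (lift a b)^[q] x = x + p := by
  obtain ⟨r, hr⟩ := h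
  rw [rotationNumber_S] at hr
  set τ := (lift a b).translationNumber with hτ
  have h1 : τ = ((r + ⌊τ⌋ : ℚ) : ℝ) := by
    push_cast; rw [← hr, Int.fract]; ring
  set s : ℚ := r + ⌊τ⌋
  have h2 : τ = (s.num : ℝ) / (s.den : ℝ) := by
    rw [h1]; exact_mod_cast (Rat.num_div_den s).symm
  obtain ⟨x, hx⟩ := ((lift a b).translationNumber_eq_rat_iff (continuous_lift a b) s.den_pos).mp h2
  exact ⟨s.den, s.num, x, s.den_pos, by rwa [← CircleDeg1Lift.coe_pow]⟩

/-- A ray mapped to itself by `T^q` with stretching factor `1` carries periodic orbits. -/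
lemma hasPeriodicOrbit_of_stretch_eq_one {a b t : ℝ} {q : ℕ} {p : ℤ} (hq : 0 < q)
    (ht : (lift a b)^[q] t = t + p) (h1 : stretch a b q t = 1) : HasPeriodicOrbit a b :=
  ⟨dir t, dir_ne_zero t, q, hq, by
    change (T a b)^[q] (dir t) = dir t
    rw [T_iterate_dir, h1, ht, dir_add_int, one_smul]⟩

theorem hasPeriodicOrbit_of_bounded_of_rational {a b : ℝ} {v : ℝ × ℝ} (hv : v ≠ 0)
    (hb : HasBoundedOrbit a b v) (h : ∃ q : ℚ, rotationNumber (S a b) = (q : ℝ)) :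
    HasPeriodicOrbit a b := by
  have hpi := Real.pi_pos
  obtain ⟨q, p, x₀, hq, hx₀⟩ := exists_iterate_eq_add_int h
  obtain ⟨c, t₀, hc, rfl⟩ := exists_eq_smul_dir hv
  obtain ⟨M, hM⟩ := hasBoundedOrbit_iff.mp hb
  -- the return map on angles
  set f : ℝ → ℝ := fun t => (lift a b)^[q] t - p with hf
  have hfm : StrictMono f := fun x y hxy => sub_lt_sub_right ((strictMono_lift a b).iterate q hxy) _
  have hfc : Continuous f := ((continuous_lift a b).iterate q).sub continuous_const
  have hfper : ∀ (t : ℝ) (m : ℤ), f (t + m) = f t + m := fun t m => by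
    simp only [hf, ← CircleDeg1Lift.coe_pow, CircleDeg1Lift.map_add_int]; ring
  obtain ⟨y, hy, hlim⟩ := exists_tendsto_iterate hfm.monotone hfc hfper
    (show f x₀ = x₀ by simp [hf, hx₀]) t₀
  have hdir : ∀ t, dir ((lift a b)^[q] t) = dir (f t) := fun t => by
    rw [← dir_add_int (f t) p]; simp [hf]
  have hret : ∀ t, (T a b)^[q] (dir t) = stretch a b q t • dir (f t) := fun t => by
    rw [T_iterate_dir, hdir]
  set l := stretch a b q y with hl
  have hlpos : 0 < l := stretch_pos a b y q
  by_contra hnp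
  have hl1 : l ≠ 1 := fun h1 => hnp <| hasPeriodicOrbit_of_stretch_eq_one hq
    (p := p) (t := y) (by simp only [hf] at hy; linarith) h1
  -- the orbit of `c • dir t₀` under the return map
  set u : ℕ → ℝ × ℝ := fun n => ((T a b)^[q])^[n] (c • dir t₀) with hu
  have hus : ∀ n, u (n + 1) = (T a b)^[q] (u n) := fun n => iterate_succ_apply' _ _ _
  have huz : ∀ n, u n = (T a b ^ ((q * n : ℕ) : ℤ)) (c • dir t₀) := fun n => by
    rw [zpow_natCast, ← Equiv.Perm.iterate_eq_pow, iterate_mul]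
  have hud : ∀ n, ∃ r : ℝ, 0 < r ∧ u n = r • dir (f^[n] t₀) := by
    intro n
    induction n with
    | zero => exact ⟨c, hc, rfl⟩
    | succ n ih =>
      obtain ⟨r, hr, hn⟩ := ih
      refine ⟨r * stretch a b q (f^[n] t₀), mul_pos hr (stretch_pos _ _ _ _), ?_⟩
      rw [hus, hn, T_iterate_smul a b q hr, hret, smul_smul, iterate_succ_apply']
  choose r hr hur using hud
  have hrs : ∀ n, r (n + 1) = r n * stretch a b q (f^[n] t₀) := fun n => by
    have h1 := hus n
    rw [hur, hur, T_iterate_smul a b q (hr n), hret, smul_smul, iterate_succ_apply'] at h1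
    have h2 := congrArg nrm h1
    rwa [nrm_smul_dir (hr _).le,
      nrm_smul_dir (mul_pos (hr n) (stretch_pos _ _ _ _)).le] at h2
  have hrM : ∀ n, r n ≤ 2 * M := fun n => by
    have h1 : nrm (u n) = r n := by rw [hur, nrm_smul_dir (hr n).le]
    have h2 : ‖u n‖ ≤ M := by rw [huz]; exact hM _
    have h3 := nrm_le_two_mul_norm (u n)
    linarith
  have hsl : Tendsto (fun n => stretch a b q (f^[n] t₀)) atTop (𝓝 l) :=
    ((continuous_stretch a b q).tendsto y).comp hlim
  rcases lt_or_gt_of_ne hl1 with hlt | hgt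
  · -- areas spanned with the limit ray would grow
    have hdet : ∀ᶠ n in atTop, l⁻¹ * |r n * Real.sin (2 * Real.pi * (y - f^[n] t₀))| ≤
        |r (n + 1) * Real.sin (2 * Real.pi * (y - f^[n + 1] t₀))| := by
      filter_upwards [((continuous_dir.tendsto y).comp hlim).eventually
        (eventually_det_T_iterate a b q (dir y))] with n hn
      have e1 : (T a b)^[q] (dir (f^[n] t₀)) =
          stretch a b q (f^[n] t₀) • dir (f^[n + 1] t₀) := by
        rw [hret, iterate_succ_apply']
      have e2 : (T a b)^[q] (dir y) = l • dir y := by rw [hret, hy]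
      have e3 := det_smul_dir 1 1 (f^[n] t₀) y
      rw [one_smul, one_smul, one_mul, one_mul] at e3
      rw [comp_apply, e1, e2, det_smul_dir, e3] at hn
      rw [hrs, ← hn, inv_mul_le_iff₀ hlpos, ← abs_of_pos hlpos, ← abs_mul, abs_of_pos hlpos]
      exact le_of_eq (congrArg _ (by ring))
    have hz := eventually_nonpos_of_geom_growth (M := 2 * M) ((one_lt_inv₀ hlpos).mpr hlt)
      (fun n => by
        rw [abs_mul, abs_of_pos (hr n)]
        exact (mul_le_of_le_one_right (hr n).le (Real.abs_sin_le_one _)).trans (hrM n)) hdet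
    -- Within half a turn of `y` the sine vanishes only at `y`. So the orbit reaches the limit ray,
    -- and by injectivity it started there.
    obtain ⟨n, hn0, hclose⟩ := (hz.and (hlim.eventually
      (Metric.ball_mem_nhds y (show (0 : ℝ) < 1 / 2 by norm_num)))).exists
    rw [Real.dist_eq, abs_lt] at hclose
    have hsin : Real.sin (2 * Real.pi * (y - f^[n] t₀)) = 0 := by
      rcases mul_eq_zero.mp (abs_eq_zero.mp (le_antisymm hn0 (abs_nonneg _))) with h | h
      · exact absurd h (hr n).ne'
      · exact h
    rw [Real.sin_eq_zero_iff_of_lt_of_lt (by nlinarith) (by nlinarith)] at hsin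
    have hny : f^[n] t₀ = y := by
      rcases mul_eq_zero.mp hsin with h | h <;> linarith
    have ht₀ : t₀ = y := (hfm.injective.iterate n) (hny.trans (iterate_fixed hy n).symm)
    -- going backwards on the limit ray the orbit grows
    have hback : ∀ n : ℕ, (T a b ^ (-(q * n : ℕ) : ℤ)) (c • dir t₀) = (c * l⁻¹ ^ n) • dir y := by
      intro n
      rw [zpow_neg, Equiv.Perm.inv_eq_iff_eq, zpow_natCast, ← Equiv.Perm.iterate_eq_pow,
        iterate_mul, ht₀]
      induction n with
      | zero => simp
      | succ n ih =>
        rw [iterate_succ_apply, T_iterate_smul a b q (by positivity), hret, hy, smul_smul, ← hl,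
          pow_succ, mul_assoc, mul_assoc, inv_mul_cancel₀ hlpos.ne', mul_one]
        exact ih
    have hgrow := eventually_nonpos_of_geom_growth (d := fun n => c * l⁻¹ ^ n) (M := 2 * M)
      ((one_lt_inv₀ hlpos).mpr hlt) (fun n => by
        have hp : 0 < c * l⁻¹ ^ n := by positivity
        have h1 : nrm ((c * l⁻¹ ^ n) • dir y) = c * l⁻¹ ^ n := nrm_smul_dir hp.le y
        have h2 : ‖(c * l⁻¹ ^ n) • dir y‖ ≤ M := by rw [← hback]; exact hM _
        have h3 := nrm_le_two_mul_norm ((c * l⁻¹ ^ n) • dir y)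
        linarith)
      (Eventually.of_forall fun n => le_of_eq (by ring))
    obtain ⟨n, hn⟩ := hgrow.exists
    have : 0 < c * l⁻¹ ^ n := by positivity
    linarith
  -- The stretching factors along the orbit tend to `l > 1`, so they eventually exceed the midpoint
  -- of 1 and `l`.
  · have hgrow := eventually_nonpos_of_geom_growth (d := r) (r := (1 + l) / 2) (M := 2 * M)
      (by linarith) hrM (by
        filter_upwards [hsl.eventually_const_lt (show (1 + l) / 2 < l by linarith)] with n hn
        rw [hrs, mul_comm]
        exact mul_le_mul_of_nonneg_left hn.le (hr n).le)
    obtain ⟨n, hn⟩ := hgrow.exists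
    exact absurd (hr n) (not_lt.mpr hn)

/-! ### Periodic orbits near irrational rotation numbers -/

/-- If a continuous family of 1-periodic functions starts positive and takes a nonpositive value
at the end, then some member has minimum zero. -/
lemma exists_min_eq_zero {H : ℝ → ℝ → ℝ} (hc : Continuous ↿H)
    (hper : ∀ s t, H s (t + 1) = H s t) {ε y : ℝ} (hε : 0 ≤ ε) (h0 : ∀ t, 0 < H 0 t)
    (h1 : H ε y ≤ 0) : ∃ s ∈ Set.Icc 0 ε, ∃ x, H s x = 0 ∧ ∀ t, 0 ≤ H s t := by
  have hK : IsCompact (Set.Icc (0 : ℝ) 1) := isCompact_Icc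
  have hne : (Set.Icc (0 : ℝ) 1).Nonempty := ⟨0, by simp⟩
  have hcs : ∀ s, Continuous (H s) := fun s =>
    hc.comp (f := fun t : ℝ => (s, t)) (by fun_prop)
  -- By periodicity the minimum over `[0, 1]` is global; it depends continuously on `s`, so the
  -- intermediate value theorem applies.
  set m : ℝ → ℝ := fun s => sInf (H s '' Set.Icc 0 1) with hm
  have hmc : Continuous m := hK.continuous_sInf hc
  have hatt : ∀ s, ∃ x, H s x = m s := fun s => by
    obtain ⟨x, -, hx⟩ := hK.exists_sInf_image_eq hne (hcs s).continuousOn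
    exact ⟨x, hx.symm⟩
  have hle : ∀ s t, m s ≤ H s t := fun s t => by
    have hp : Function.Periodic (H s) 1 := hper s
    obtain ⟨x, hx, hxt⟩ := hp.exists_mem_Ico₀ one_pos t
    rw [hxt]
    exact csInf_le (hK.image (hcs s)).bddBelow ⟨x, ⟨hx.1, hx.2.le⟩, rfl⟩
  obtain ⟨x₀, hx₀⟩ := hatt 0
  have hpos : 0 ≤ m 0 := hx₀ ▸ (h0 x₀).le
  obtain ⟨s, hs, hs0⟩ := intermediate_value_Icc' hε hmc.continuousOn
    (show (0 : ℝ) ∈ Set.Icc (m ε) (m 0) from ⟨(hle ε y).trans h1, hpos⟩)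
  obtain ⟨x, hx⟩ := hatt s
  exact ⟨s, hs, x, hx.trans hs0, fun t => hs0 ▸ hle s t⟩

/-- The last hypothesis says that `D` lies at least as far from 0 as `d`, on the same side, and sine
is increasing on this range. -/
lemma le_one_of_mul_sin_eq {d D K : ℝ} (hK : 0 < K) (hd : |d| < Real.pi / 2)
    (hD : |D| < Real.pi / 2) (h0 : d ≠ 0) (h : K * Real.sin D = Real.sin d)
    (hs : 0 ≤ d * (D - d)) : K ≤ 1 := by
  rw [abs_lt] at hd hD
  have hpi := Real.pi_pos
  rcases lt_or_gt_of_ne h0 with hneg | hpos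
  · have hle : Real.sin D ≤ Real.sin d :=
      Real.sin_le_sin_of_le_of_le_pi_div_two (by linarith) (by linarith) (by nlinarith)
    have := Real.sin_neg_of_neg_of_neg_pi_lt hneg (by linarith)
    nlinarith
  · have hle : Real.sin d ≤ Real.sin D :=
      Real.sin_le_sin_of_le_of_le_pi_div_two (by linarith) (by linarith) (by nlinarith)
    have := Real.sin_pos_of_pos_of_lt_pi hpos (by linarith)
    nlinarith

lemma one_le_of_mul_sin_eq {d D K : ℝ} (hK : 0 < K) (hd : |d| < Real.pi / 2)
    (hD : |D| < Real.pi / 2) (h0 : d ≠ 0) (h : K * Real.sin D = Real.sin d)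
    (hs : d * (D - d) ≤ 0) : 1 ≤ K := by
  rw [abs_lt] at hd hD
  have hpi := Real.pi_pos
  rcases lt_or_gt_of_ne h0 with hneg | hpos
  · have hle : Real.sin d ≤ Real.sin D :=
      Real.sin_le_sin_of_le_of_le_pi_div_two (by linarith) (by linarith) (by nlinarith)
    have := Real.sin_neg_of_neg_of_neg_pi_lt hneg (by linarith)
    nlinarith
  · have hle : Real.sin D ≤ Real.sin d :=
      Real.sin_le_sin_of_le_of_le_pi_div_two (by linarith) (by linarith) (by nlinarith)
    have := Real.sin_pos_of_pos_of_lt_pi hpos (by linarith)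
    nlinarith

/-- At a fixed angle where the return map touches the identity from one side, area preservation
forces the stretching factor to be `1`. -/
lemma stretch_eq_one_of_tangent {a b x : ℝ} {q : ℕ} {p : ℤ} (hx : (lift a b)^[q] x = x + p)
    (h : (∀ t, t + p ≤ (lift a b)^[q] t) ∨ ∀ t, (lift a b)^[q] t ≤ t + p) :
    stretch a b q x = 1 := by
  have hpi := Real.pi_pos
  set f := (lift a b)^[q] with hf
  have hfc : Continuous f := (continuous_lift a b).iterate q
  set l := stretch a b q x with hl
  have hlpos : 0 < l := stretch_pos a b x q
  have hkc : Continuous fun t => l * stretch a b q t :=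
    continuous_const.mul (continuous_stretch a b q)
  have hkpos : ∀ t, 0 < l * stretch a b q t := fun t => mul_pos hlpos (stretch_pos a b t q)
  -- This is preservation of the area spanned with the fixed ray, written in angles.
  have hev : ∀ᶠ t in 𝓝 x, |2 * Real.pi * (t - x)| < Real.pi / 2 ∧
      |2 * Real.pi * (f t - p - x)| < Real.pi / 2 ∧
      l * stretch a b q t * Real.sin (2 * Real.pi * (f t - p - x)) =
        Real.sin (2 * Real.pi * (t - x)) := by
    have h1 : Continuous fun t => |2 * Real.pi * (t - x)| := by fun_prop
    have h2 : Continuous fun t => |2 * Real.pi * (f t - p - x)| := by fun_prop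
    filter_upwards [(h1.tendsto x).eventually_lt_const (u := Real.pi / 2) (by simp; positivity),
      (h2.tendsto x).eventually_lt_const (u := Real.pi / 2) (by simp [hx]; positivity),
      (continuous_dir.tendsto x).eventually (eventually_det_T_iterate a b q (dir x))]
      with t e1 e2 e3
    refine ⟨e1, e2, ?_⟩
    have hodd : ∀ u v : ℝ, Real.sin (2 * Real.pi * (u - v)) = -Real.sin (2 * Real.pi * (v - u)) :=
      fun u v => by rw [← Real.sin_neg]; congr 1; ring
    have hd : dir (f t) = dir (f t - p) := by rw [← dir_add_int (f t - p) p, sub_add_cancel]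
    have e4 := det_smul_dir 1 1 t x
    rw [one_smul, one_smul, one_mul, one_mul] at e4
    rw [T_iterate_dir, T_iterate_dir, ← hf, hx, dir_add_int, hd, det_smul_dir, e4, ← hl,
      hodd x, hodd x] at e3
    linarith
  -- If angles on one side move away from `x`, the product of stretching factors is at most 1 there;
  -- letting `t` tend to `x` bounds `l * l`. `hdown` is the case of angles moving in the opposite
  -- direction.
  have hup : ∀ {s : Set ℝ} [(𝓝[s] x).NeBot], (∀ t ∈ s, t ≠ x) →
      (∀ t ∈ s, 0 ≤ (t - x) * (f t - p - t)) → l * l ≤ 1 := by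
    intro s _ hs h
    refine le_of_tendsto ((hkc.tendsto x).mono_left (nhdsWithin_le_nhds (s := s))) ?_
    filter_upwards [self_mem_nhdsWithin, nhdsWithin_le_nhds hev] with t ht ⟨e1, e2, e3⟩
    refine le_one_of_mul_sin_eq (hkpos t) e1 e2 ?_ e3 ?_
    · exact mul_ne_zero (by positivity) (sub_ne_zero.mpr (hs t ht))
    · have := mul_nonneg (sq_nonneg (2 * Real.pi)) (h t ht)
      linarith
  have hdown : ∀ {s : Set ℝ} [(𝓝[s] x).NeBot], (∀ t ∈ s, t ≠ x) →
      (∀ t ∈ s, (t - x) * (f t - p - t) ≤ 0) → 1 ≤ l * l := by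
    intro s _ hs h
    refine ge_of_tendsto ((hkc.tendsto x).mono_left (nhdsWithin_le_nhds (s := s))) ?_
    filter_upwards [self_mem_nhdsWithin, nhdsWithin_le_nhds hev] with t ht ⟨e1, e2, e3⟩
    refine one_le_of_mul_sin_eq (hkpos t) e1 e2 ?_ e3 ?_
    · exact mul_ne_zero (by positivity) (sub_ne_zero.mpr (hs t ht))
    · have := mul_nonneg (sq_nonneg (2 * Real.pi)) (neg_nonneg.mpr (h t ht))
      linarith
  have hgt : ∀ t ∈ Set.Ioi x, t ≠ x := fun t ht => ne_of_gt ht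
  have hlt : ∀ t ∈ Set.Iio x, t ≠ x := fun t ht => ne_of_lt ht
  -- A return map touching the identity from one side repels on one side of `x` and moves angles
  -- back on the other, so both bounds apply.
  have hsq : l * l = 1 := by
    rcases h with h | h
    · refine le_antisymm (hup hgt fun t ht => ?_) (hdown hlt fun t ht => ?_)
      · exact mul_nonneg (sub_nonneg.mpr (Set.mem_Ioi.mp ht).le) (by linarith [h t])
      · exact mul_nonpos_of_nonpos_of_nonneg (sub_nonpos.mpr (Set.mem_Iio.mp ht).le)
          (by linarith [h t])
    · refine le_antisymm (hup hlt fun t ht => ?_) (hdown hgt fun t ht => ?_)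
      · exact mul_nonneg_of_nonpos_of_nonpos (sub_nonpos.mpr (Set.mem_Iio.mp ht).le)
          (by linarith [h t])
      · exact mul_nonpos_of_nonneg_of_nonpos (sub_nonneg.mpr (Set.mem_Ioi.mp ht).le)
          (by linarith [h t])
  nlinarith

/-- One step is not strict on the second axis, but `T` sends that axis to the first one, where the
next step is strict. -/
lemma lift_iterate_two_add_lt (a b t : ℝ) {s : ℝ} (hs : 0 < s) :
    (lift (a + s) (b + s))^[2] t < (lift a b)^[2] t := by
  have hle : ∀ t, lift (a + s) (b + s) t ≤ lift a b t := fun t => by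
    by_cases h : Real.cos (2 * Real.pi * t) = 0
    · exact (lift_add_eq a b t s h).le
    · exact (lift_add_lt a b t hs h).le
  change lift (a + s) (b + s) (lift (a + s) (b + s) t) < lift a b (lift a b t)
  by_cases h : Real.cos (2 * Real.pi * t) = 0
  · rw [lift_add_eq a b t s h]
    refine lift_add_lt a b _ hs ?_
    obtain ⟨r, -, hT⟩ := exists_T_dir a b t
    have h1 := congrArg Prod.fst hT
    simp only [T, dir, Equiv.coe_fn_mk, h, mul_zero, zero_sub, Prod.smul_mk, smul_eq_mul] at h1
    intro h2
    rw [h2, mul_zero, neg_eq_zero] at h1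
    have := Real.sin_sq_add_cos_sq (2 * Real.pi * t)
    rw [h, h1] at this
    norm_num at this
  · exact (strictMono_lift _ _ (lift_add_lt a b t hs h)).trans_le (hle _)

lemma exists_uniform_gap {F G : CircleDeg1Lift} (hF : Continuous F) (hG : Continuous G)
    (h : ∀ t, F t < G t) : ∃ η > 0, ∀ t, F t + η ≤ G t := by
  obtain ⟨x, -, hx⟩ := (isCompact_Icc (a := (0 : ℝ)) (b := 1)).exists_isMinOn ⟨0, by simp⟩
    (hG.sub hF).continuousOn
  refine ⟨G x - F x, sub_pos.mpr (h x), fun t => ?_⟩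
  have h1 := hx (show Int.fract t ∈ Set.Icc (0 : ℝ) 1 from
    ⟨Int.fract_nonneg t, (Int.fract_lt_one t).le⟩)
  have h2 := F.map_fract_sub_fract_eq t
  have h3 := G.map_fract_sub_fract_eq t
  change G x - F x ≤ G (Int.fract t) - F (Int.fract t) at h1
  linarith

/-- The gap comes from the last step alone, so it does not depend on `n`: the number of iterates can
be chosen after `η`. -/
lemma iterate_add_le_iterate {F G : CircleDeg1Lift} {η : ℝ} (hη : 0 ≤ η)
    (h : ∀ t, F t + η ≤ G t) {n : ℕ} (hn : 0 < n) (t : ℝ) : F^[n] t + η ≤ G^[n] t := by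
  obtain ⟨k, rfl⟩ := Nat.exists_eq_succ_of_ne_zero hn.ne'
  have hle : F ≤ G := fun t => by linarith [h t]
  rw [iterate_succ_apply', iterate_succ_apply']
  exact (h _).trans (G.monotone (CircleDeg1Lift.iterate_mono hle k t))

/-- Some orbit of a map of the line returns arbitrarily close to itself modulo `1`. -/
lemma exists_iterate_near_add_int (G : ℝ → ℝ) {η : ℝ} (hη : 0 < η) :
    ∃ (y : ℝ) (n : ℕ) (p : ℤ), 0 < n ∧ |G^[n] y - y - p| < η := by
  -- Two close terms of a convergent subsequence of fractional parts give the return; their integer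
  -- parts give `p`.
  obtain ⟨z, -, φ, hφ, hz⟩ := (isCompact_Icc (a := (0 : ℝ)) (b := 1)).tendsto_subseq
    (x := fun n : ℕ => Int.fract (G^[n] 0))
    fun n => ⟨Int.fract_nonneg _, (Int.fract_lt_one _).le⟩
  obtain ⟨N, hN⟩ := Metric.cauchySeq_iff'.mp hz.cauchySeq η hη
  have h1 := hN (N + 1) (by omega)
  have hlt : φ N < φ (N + 1) := hφ (by omega)
  refine ⟨G^[φ N] 0, φ (N + 1) - φ N, ⌊G^[φ (N + 1)] 0⌋ - ⌊G^[φ N] 0⌋, by omega, ?_⟩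
  rw [← iterate_add_apply, Nat.sub_add_cancel hlt.le]
  rw [Real.dist_eq, comp_apply, comp_apply, Int.fract, Int.fract] at h1
  push_cast
  convert h1 using 2
  ring

lemma pos_of_continuous_of_ne_zero {f : ℝ → ℝ} (hf : Continuous f) (h0 : ∀ t, f t ≠ 0) {y : ℝ}
    (hy : 0 < f y) (t : ℝ) : 0 < f t := by
  by_contra! h
  obtain ⟨x, hx⟩ := mem_range_of_exists_le_of_exists_ge hf ⟨t, h⟩ ⟨y, hy.le⟩
  exact h0 x hx

theorem exists_hasPeriodicOrbit_near_of_irrational {a b : ℝ}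
    (h : Irrational (rotationNumber (S a b))) {ε : ℝ} (hε : 0 < ε) :
    ∃ s, |s| ≤ ε ∧ HasPeriodicOrbit (a + s) (b + s) := by
  -- A point periodic modulo 1 would make the rotation number rational.
  have hirr : ∀ (n : ℕ) (p : ℤ) (t : ℝ), 0 < n → (lift a b)^[n] t ≠ t + p := by
    intro n p t hn ht
    rw [← CircleDeg1Lift.coe_pow] at ht
    have := (lift a b).translationNumber_of_map_pow_eq_add_int ht hn
    rw [rotationNumber_S, this, Int.fract] at h
    exact h ⟨(p : ℚ) / n - ⌊(p : ℝ) / n⌋, by push_cast; rfl⟩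
  have hc2 : ∀ a b, Continuous (lift a b ^ 2 : CircleDeg1Lift) := fun a b =>
    (lift a b).continuous_pow (continuous_lift a b) 2
  have hlt : ∀ (a b t : ℝ) {s : ℝ}, 0 < s →
      (lift (a + s) (b + s) ^ 2 : CircleDeg1Lift) t < (lift a b ^ 2 : CircleDeg1Lift) t := by
    intro a b t s hs
    rw [CircleDeg1Lift.coe_pow, CircleDeg1Lift.coe_pow]
    exact lift_iterate_two_add_lt a b t hs
  obtain ⟨η₁, hη₁, hg₁⟩ := exists_uniform_gap (hc2 (a + ε) (b + ε)) (hc2 a b)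
    fun t => hlt a b t hε
  obtain ⟨η₂, hη₂, hg₂⟩ := exists_uniform_gap (hc2 a b) (hc2 (a + -ε) (b + -ε)) fun t => by
    simpa using hlt (a + -ε) (b + -ε) t hε
  -- The return defect at `y` is smaller than the shift caused by `±ε`, so one of the two
  -- perturbations reverses or cancels it, whatever its sign.
  obtain ⟨y, n, p, hn, hy⟩ := exists_iterate_near_add_int (lift a b ^ 2 : CircleDeg1Lift)
    (lt_min hη₁ hη₂)
  have hr₁ := iterate_add_le_iterate hη₁.le hg₁ hn y
  have hr₂ := iterate_add_le_iterate hη₂.le hg₂ hn y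
  simp only [CircleDeg1Lift.coe_pow, ← iterate_mul] at hy hr₁ hr₂
  have hn2 : 0 < 2 * n := by omega
  set H : ℝ → ℝ → ℝ := fun s t => (lift (a + s) (b + s))^[2 * n] t - t - p with hH
  have hHc : Continuous ↿H := by
    have : Continuous fun q : ℝ × ℝ => (lift (a + q.1) (b + q.1))^[2 * n] q.2 :=
      (continuous_lift_iterate (2 * n)).comp
        (f := fun q : ℝ × ℝ => (a + q.1, b + q.1, q.2)) (by fun_prop)
    exact (this.sub continuous_snd).sub continuous_const
  have hHper : ∀ s t, H s (t + 1) = H s t := fun s t => by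
    simp only [hH, ← CircleDeg1Lift.coe_pow, CircleDeg1Lift.map_add_one]; ring
  have hH0 : ∀ t, H 0 t ≠ 0 := fun t ht => hirr (2 * n) p t hn2 (by
    simp only [hH, add_zero] at ht; linarith)
  have hH0c : Continuous (H 0) := hHc.comp (f := fun t : ℝ => ((0 : ℝ), t)) (by fun_prop)
  have hy0 : H 0 y = (lift a b)^[2 * n] y - y - p := by simp only [hH, add_zero]
  rw [← hy0, lt_min_iff] at hy
  rcases lt_or_gt_of_ne (hH0 y) with hneg | hpos
  -- Here the parameters must decrease, so the minimum argument is applied to `-H (-s)`.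
  · have h0 := pos_of_continuous_of_ne_zero hH0c.neg (fun t => neg_ne_zero.mpr (hH0 t))
      (neg_pos.mpr hneg)
    have hlast : -H (-ε) y ≤ 0 := by
      have := (abs_lt.mp hy.2).1
      simp only [hH, add_zero] at this ⊢
      linarith
    obtain ⟨s, hs, x, hx, hmin⟩ := exists_min_eq_zero (H := fun s t => -H (-s) t)
      (hHc.comp (f := fun q : ℝ × ℝ => (-q.1, q.2)) (by fun_prop)).neg
      (fun s t => by rw [hHper]) hε.le (fun t => by simpa using h0 t) hlast
    have hxe : (lift (a + -s) (b + -s))^[2 * n] x = x + p := by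
      simp only [hH] at hx; linarith
    exact ⟨-s, by rw [abs_neg, abs_of_nonneg hs.1]; exact hs.2,
      hasPeriodicOrbit_of_stretch_eq_one hn2 hxe (stretch_eq_one_of_tangent hxe
        (Or.inr fun t => by have := hmin t; simp only [hH] at this; linarith))⟩
  · have h0 := pos_of_continuous_of_ne_zero hH0c hH0 hpos
    have hlast : H ε y ≤ 0 := by
      have := (abs_lt.mp hy.1).2
      simp only [hH, add_zero] at this ⊢
      linarith
    obtain ⟨s, hs, x, hx, hmin⟩ := exists_min_eq_zero hHc hHper hε.le h0 hlast
    have hxe : (lift (a + s) (b + s))^[2 * n] x = x + p := by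
      simp only [hH] at hx; linarith
    exact ⟨s, by rw [abs_of_nonneg hs.1]; exact hs.2,
      hasPeriodicOrbit_of_stretch_eq_one hn2 hxe (stretch_eq_one_of_tangent hxe
        (Or.inl fun t => by have := hmin t; simp only [hH] at this; linarith))⟩

/-- Adding `s` to both `a` and `b` changes only `ν`, by `s`; so nearby parameters have periodic
orbits, and the set is closed. -/
theorem mem_omegaSB_of_irrational {μ ν : ℝ}
    (h : Irrational (rotationNumber (S (ν + μ) (ν - μ)))) : (μ, ν) ∈ OmegaSB := by
  rw [← isClosed_omegaSB.closure_eq, Metric.mem_closure_iff]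
  intro ε hε
  obtain ⟨s, hs, hp⟩ := exists_hasPeriodicOrbit_near_of_irrational h (half_pos hε)
  refine ⟨(μ, ν + s), ?_, ?_⟩
  · rw [show ν + μ + s = ν + s + μ by ring, show ν - μ + s = ν + s - μ by ring] at hp
    exact hp.exists_bounded
  · rw [Prod.dist_eq, dist_self, Real.dist_eq, max_lt_iff]
    refine ⟨hε, ?_⟩
    rw [show ν - (ν + s) = -s by ring, abs_neg]
    linarith

end PLMap

end

theorem theorem2p6 :
    IsClosed PLMap.OmegaSB ∧
    ∀ μ ν a b : ℝ, a = ν + μ → b = ν - μ →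
      ((μ, ν) ∈ PLMap.OmegaSB ↔
        ((∃ q : ℚ, PLMap.rotationNumber (PLMap.S a b) = (q : ℝ)) ∧ PLMap.HasPeriodicOrbit a b) ∨
          Irrational (PLMap.rotationNumber (PLMap.S a b))) := by
  refine ⟨PLMap.isClosed_omegaSB, ?_⟩
  rintro μ ν _ _ rfl rfl
  constructor
  · rintro ⟨v, hv, hb⟩
    by_cases h : ∃ q : ℚ, PLMap.rotationNumber (PLMap.S (ν + μ) (ν - μ)) = (q : ℝ)
    · exact Or.inl ⟨h, PLMap.hasPeriodicOrbit_of_bounded_of_rational hv hb h⟩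
    · exact Or.inr fun ⟨q, hq⟩ => h ⟨q, hq.symm⟩
  · rintro (⟨-, h⟩ | h)
    · exact h.exists_bounded
    · exact PLMap.mem_omegaSB_of_irrational h
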